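/- Let $\mathbf a=(a_n)_{n\ge 0}$ be a sequence of complex numbers whose Rhaly (terraced) matrix $$(R_{\mathbf a}x)_n=a_n\sum_{k=0}^{n}x_k ,\qquad n\ge 0,$$ acts boundedly on $\ell^2$, and let $R_{\mathbf a}^*$ be the Hilbert space adjoint of the resulting operator $R_{\mathbf a}$. Write $\overline{\mathbf a}=\{\overline{a_n}: n\ge 0\}$ for the set of the complex conjugates of the terms of $\mathbf a$. For a bounded operator $T$ on $\ell^2$ let $\sigma(T)$ be its spectrum, $\sigma_p(T)$ its point spectrum (the set of eigenvalues), $\sigma_l(T)$ its left spectrum (the set of $\lambda\in\mathbb C$ for which $\lambda-T$ has no bounded left inverse), and $\sigma_{lre}(T)$ its left-right essential (Wolf) spectrum, i.e. the intersection of the left spectrum and the right spectrum of the class of $T$ in the Calkin algebra of bounded operators modulo compact operators. Then: (i) $\sigma(R_{\mathbf a}^*)=\sigma_l(R_{\mathbf a}^*)=\sigma_{lre}(R_{\mathbf a}^*)\cup\sigma_p(R_{\mathbf a}^*)$. (ii) Every non-empty subset of $\sigma(R_{\mathbf a}^*)$ that is clopen in $\sigma(R_{\mathbf a}^*)$ intersects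 $\overline{\mathbf a}$. Moreover, every connected component of $\sigma(R_{\mathbf a}^*)$ intersects the topological closure of $\overline{\mathbf a}$ in $\mathbb C$. (iii) Every isolated point of $\sigma(R_{\mathbf a}^*)$ belongs to $\overline{\mathbf a}$. -/

import Mathlib

noncomputable section

/-- The Hilbert space `ℓ²` of square-summable complex sequences indexed by `0, 1, 2, …`. -/
abbrev EllTwo : Type := lp (fun _ : ℕ => ℂ) 2

/-- The terraced (Rhaly) matrix of `a`: the `n`-th row is `a n, …, a n, 0, 0, …`, with `n + 1`
entries equal to `a n`. -/
def rhalyMatrix (a : ℕ → ℂ) : Matrix ℕ ℕ ℂ := fun n k => if k ≤ n then a n else 0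

/-- The formal action of the terraced matrix on an arbitrary sequence. Every row has only
finitely many non-zero entries, all of them in the columns `0, …, n`. -/
def rhalyMap (a : ℕ → ℂ) : (ℕ → ℂ) →ₗ[ℂ] (ℕ → ℂ) where
  toFun x n := ∑ k ∈ Finset.range (n + 1), rhalyMatrix a n k * x k
  map_add' x y := by
    funext n
    simp [mul_add, Finset.sum_add_distrib]
  map_smul' c x := by
    funext n
    simp [Finset.mul_sum, mul_left_comm]

theorem rhalyMap_apply (a x : ℕ → ℂ) (n : ℕ) :
    rhalyMap a x n = a n * ∑ k ∈ Finset.range (n + 1), x k := by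
  simp only [rhalyMap, rhalyMatrix, LinearMap.coe_mk, AddHom.coe_mk, Finset.mul_sum]
  refine Finset.sum_congr rfl fun k hk => ?_
  rw [if_pos (Nat.lt_succ_iff.mp (Finset.mem_range.mp hk))]

/-- The Rhaly matrix of `a` acts boundedly on `ℓ²`: it maps `ℓ²` into `ℓ²`, with a finite bound. -/
structure RhalyBounded (a : ℕ → ℂ) : Prop where
  memℓp : ∀ x : EllTwo, Memℓp (rhalyMap a (x : ℕ → ℂ)) 2
  bound : ∃ C : ℝ, ∀ x : EllTwo, ‖(⟨rhalyMap a (x : ℕ → ℂ), memℓp x⟩ : EllTwo)‖ ≤ C * ‖x‖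

/-- The Rhaly operator `R_a` on `ℓ²`, for `a` whose matrix acts boundedly. -/
def rhalyOperator (a : ℕ → ℂ) (ha : RhalyBounded a) : EllTwo →L[ℂ] EllTwo :=
  LinearMap.mkContinuousOfExistsBound
    { toFun := fun x => ⟨rhalyMap a (x : ℕ → ℂ), ha.memℓp x⟩
      map_add' := fun x y => by
        apply Subtype.ext
        exact (rhalyMap a).map_add (x : ℕ → ℂ) (y : ℕ → ℂ)
      map_smul' := fun c x => by
        apply Subtype.ext
        exact (rhalyMap a).map_smul c (x : ℕ → ℂ) }
    ha.bound

theorem rhalyOperator_apply (a : ℕ → ℂ) (ha : RhalyBounded a) (x : EllTwo) (n : ℕ) :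
    rhalyOperator a ha x n = a n * ∑ k ∈ Finset.range (n + 1), x k :=
  rhalyMap_apply a x n

/-- The left spectrum of an element of a unital complex algebra: the scalars `z` for which
`z - t` has no left inverse. -/
def leftSpectrum {A : Type*} [Ring A] [Algebra ℂ A] (t : A) : Set ℂ :=
  {z | ¬ ∃ s : A, s * (algebraMap ℂ A z - t) = 1}

/-- The right spectrum of an element of a unital complex algebra: the scalars `z` for which
`z - t` has no right inverse. -/
def rightSpectrum {A : Type*} [Ring A] [Algebra ℂ A] (t : A) : Set ℂ :=
  {z | ¬ ∃ s : A, (algebraMap ℂ A z - t) * s = 1}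

/-- The point spectrum: the set of eigenvalues. -/
def pointSpectrum {H : Type*} [NormedAddCommGroup H] [NormedSpace ℂ H] (T : H →L[ℂ] H) : Set ℂ :=
  {z | Module.End.HasEigenvalue (T : H →ₗ[ℂ] H) z}

/-- The two-sided ideal of compact operators in the algebra of bounded operators. -/
def compactIdeal (H : Type*) [NormedAddCommGroup H] [NormedSpace ℂ H] :
    TwoSidedIdeal (H →L[ℂ] H) :=
  TwoSidedIdeal.mk' {K | IsCompactOperator K}
    (isCompactOperator_zero)
    (fun hx hy => IsCompactOperator.add hx hy)
    (fun hx => IsCompactOperator.neg hx)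
    (fun {x _} hy => IsCompactOperator.clm_comp hy x)
    (fun {_ y} hx => IsCompactOperator.comp_clm hx y)

/-- The Calkin algebra: bounded operators modulo compact operators. -/
abbrev CalkinAlgebra (H : Type*) [NormedAddCommGroup H] [NormedSpace ℂ H] : Type _ :=
  (compactIdeal H).ringCon.Quotient

/-- The class of a bounded operator in the Calkin algebra. -/
def toCalkin {H : Type*} [NormedAddCommGroup H] [NormedSpace ℂ H] (T : H →L[ℂ] H) :
    CalkinAlgebra H :=
  (compactIdeal H).ringCon.mk' T

/-- The left-right essential spectrum (Wolf spectrum): the intersection of the left and of the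
right spectrum of the class of the operator in the Calkin algebra. -/
def wolfSpectrum {H : Type*} [NormedAddCommGroup H] [NormedSpace ℂ H] (T : H →L[ℂ] H) : Set ℂ :=
  leftSpectrum (toCalkin T) ∩ rightSpectrum (toCalkin T)

end

/-! `T = R_a^*` is upper triangular with diagonal `conj (a n)`, so it preserves each
finite-dimensional space `supportedBelow n`, and every `conj (a n)` is an eigenvalue of `T`.
Conversely, `R_a` has no eigenvalues other than the `a n`. Hence, off the point spectrum, `z - T`
has injective adjoint, and a lower bound for `z - T` already makes it invertible
(`notMem_spectrum_of_norm_le`). Part (i) follows, since an injective operator that is left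
invertible modulo compacts is bounded below; this applies to `z - T` or to its adjoint.

For (ii), let `K` be a clopen part of the spectrum without conjugated terms, and surround it by a
bounded open `U` with frontier in the resolvent set. On each `supportedBelow n` the resolvent is
analytic near `closure U`, so the maximum principle carries the frontier bound into `U` with a
constant independent of `n`. By density `z - T` is bounded below for `z ∈ K`, so `K` is empty. The
claim on components follows by compactness, and (iii) is the case of a clopen singleton. -/

open Filter Topology Set ContinuousLinearMap
open scoped InnerProductSpace ComplexConjugate

/-! ### Lower bounds, compactness and invertibility in Hilbert space. -/

section Hilbert

variable {H : Type*} [NormedAddCommGroup H] [InnerProductSpace ℂ H] [CompleteSpace H]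

/-- An operator that is bounded below and whose adjoint is injective is invertible. -/
theorem isUnit_of_norm_le_of_injective_adjoint {A : H →L[ℂ] H} {C : ℝ}
    (hA : ∀ x, ‖x‖ ≤ C * ‖A x‖) (hinj : ∀ x, adjoint A x = 0 → x = 0) : IsUnit A := by
  have hanti : AntilipschitzWith C.toNNReal A := by
    refine A.antilipschitz_of_bound fun x => (hA x).trans ?_
    exact mul_le_mul_of_nonneg_right (Real.le_coe_toNNReal C) (norm_nonneg _)
  rw [isUnit_iff_bijective]
  refine ⟨hanti.injective, ?_⟩
  have hclosed : IsClosed (LinearMap.range (A : H →ₗ[ℂ] H) : Set H) := by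
    rw [LinearMap.coe_range]
    exact hanti.isClosed_range A.uniformContinuous
  have horth : (LinearMap.range (A : H →ₗ[ℂ] H))ᗮ = ⊥ := by
    rw [Submodule.eq_bot_iff]
    intro x hx
    apply hinj
    have := A.orthogonal_range
    exact LinearMap.mem_ker.1 ((SetLike.ext_iff.1 this x).1 hx)
  have htop := (Submodule.topologicalClosure_eq_top_iff).2 horth
  rw [hclosed.submodule_topologicalClosure_eq] at htop
  exact LinearMap.range_eq_top.1 htop

omit [CompleteSpace H] in
/-- The sequential form of compactness of an operator. -/
theorem IsCompactOperator.exists_cauchySeq {K : H →L[ℂ] H} (hK : IsCompactOperator K)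
    (x : ℕ → H) (hx : ∀ n, ‖x n‖ ≤ 1) :
    ∃ φ : ℕ → ℕ, StrictMono φ ∧ CauchySeq fun n => K (x (φ n)) := by
  obtain ⟨y, -, φ, hφ, hlim⟩ :=
    (hK.isCompact_closure_image_closedBall 1).tendsto_subseq (x := fun n => K (x n))
      fun n => subset_closure ⟨x n, by simpa using hx n, rfl⟩
  exact ⟨φ, hφ, hlim.cauchySeq⟩

/-- The adjoint of a compact operator is compact, in sequential form. -/
theorem IsCompactOperator.exists_cauchySeq_adjoint {K : H →L[ℂ] H} (hK : IsCompactOperator K)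
    (x : ℕ → H) (hx : ∀ n, ‖x n‖ ≤ 1) :
    ∃ φ : ℕ → ℕ, StrictMono φ ∧ CauchySeq fun n => adjoint K (x (φ n)) := by
  obtain ⟨φ, hφ, hc⟩ := (hK.comp_clm (adjoint K)).exists_cauchySeq (K := K ∘L adjoint K) x hx
  refine ⟨φ, hφ, Metric.cauchySeq_iff.2 fun ε hε => ?_⟩
  -- Differences `u` of the `x n` have norm at most 2, so `‖K* u‖² = ⟪K K* u, u⟫ ≤ 2 ‖K K* u‖`;
  -- hence `ε ^ 2 / 2`.
  obtain ⟨N, hN⟩ := Metric.cauchySeq_iff.1 hc (ε ^ 2 / 2) (by positivity)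
  refine ⟨N, fun m hm n hn => ?_⟩
  have h1 := hN m hm n hn
  rw [dist_eq_norm, ← map_sub] at h1 ⊢
  set u := x (φ m) - x (φ n)
  have hu2 : ‖u‖ ≤ 2 := (norm_sub_le _ _).trans (by linarith [hx (φ m), hx (φ n)])
  have h2 : ‖adjoint K u‖ ^ 2 ≤ ‖K (adjoint K u)‖ * ‖u‖ := by
    have h3 : ⟪K (adjoint K u), u⟫_ℂ = (‖adjoint K u‖ : ℂ) ^ 2 := by
      rw [← adjoint_inner_right, inner_self_eq_norm_sq_to_K]; rfl
    have h4 := norm_inner_le_norm (𝕜 := ℂ) (K (adjoint K u)) u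
    rw [h3] at h4
    simpa using h4
  have h5 : ‖K (adjoint K u)‖ < ε ^ 2 / 2 := h1
  have h6 : ‖adjoint K u‖ ^ 2 < ε ^ 2 := by
    nlinarith [norm_nonneg u, norm_nonneg (K (adjoint K u))]
  exact lt_of_pow_lt_pow_left₀ 2 hε.le h6

/-- An injective operator that is left invertible modulo a (sequentially) compact operator is
bounded below. -/
theorem exists_norm_le_of_mul_eq_one_add {S A L : H →L[ℂ] H} (h : S * A = 1 + L)
    (hL : ∀ x : ℕ → H, (∀ n, ‖x n‖ ≤ 1) →
      ∃ φ : ℕ → ℕ, StrictMono φ ∧ CauchySeq fun n => L (x (φ n)))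
    (hA : ∀ x, A x = 0 → x = 0) : ∃ C : ℝ, ∀ x, ‖x‖ ≤ C * ‖A x‖ := by
  by_contra! hcon
  have hex : ∀ n : ℕ, ∃ x : H, ‖x‖ = 1 ∧ ‖A x‖ ≤ 1 / ((n : ℝ) + 1) := by
    intro n
    obtain ⟨x, hx⟩ := hcon (n + 1)
    have hx0 : 0 < ‖x‖ := lt_of_le_of_lt (by positivity) hx
    refine ⟨((‖x‖⁻¹ : ℝ) : ℂ) • x, ?_, ?_⟩
    · rw [norm_smul, Complex.norm_real, norm_inv, norm_norm, inv_mul_cancel₀ hx0.ne']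
    · rw [map_smul, norm_smul, Complex.norm_real, norm_inv, norm_norm, inv_mul_le_iff₀ hx0,
        mul_one_div, le_div_iff₀ (by positivity)]
      linarith
  choose x hx1 hx2 using hex
  obtain ⟨φ, hφ, hc⟩ := hL x fun n => (hx1 n).le
  have hA0 : Tendsto (fun n => A (x (φ n))) atTop (𝓝 0) :=
    (squeeze_zero_norm hx2 tendsto_one_div_add_atTop_nhds_zero_nat).comp hφ.tendsto_atTop
  obtain ⟨y, hy⟩ := cauchySeq_tendsto_of_complete hc
  have hSA : Tendsto (fun n => S (A (x (φ n)))) atTop (𝓝 0) := by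
    simpa [Function.comp_def] using (S.continuous.tendsto 0).comp hA0
  -- Since `x = S (A x) - L x` and `A x → 0`, convergence of `L x` forces convergence of the unit
  -- vectors, to a unit vector in the kernel of `A`.
  have hxlim : Tendsto (fun n => x (φ n)) atTop (𝓝 (-y)) := by
    have := hSA.sub hy
    rw [zero_sub] at this
    refine this.congr fun n => ?_
    have := congrArg (fun B : H →L[ℂ] H => B (x (φ n))) h
    simp only [mul_apply_eq_comp, add_apply, one_apply_eq_self] at this
    rw [this, add_sub_cancel_right]
  have hn : ‖-y‖ = 1 :=
    tendsto_nhds_unique hxlim.norm (by simp [hx1])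
  have hz : A (-y) = 0 := tendsto_nhds_unique ((A.continuous.tendsto _).comp hxlim) hA0
  rw [hA _ hz, norm_zero] at hn
  exact zero_ne_one hn

end Hilbert

/-! ### Lifting one-sided inverses from the Calkin algebra. -/

section Calkin

variable {H : Type*} [NormedAddCommGroup H] [NormedSpace ℂ H]

theorem toCalkin_eq_iff {A B : H →L[ℂ] H} :
    toCalkin A = toCalkin B ↔ IsCompactOperator (A - B) := by
  change (A : (compactIdeal H).ringCon.Quotient) = B ↔ _
  rw [RingCon.eq, TwoSidedIdeal.rel_iff]
  exact TwoSidedIdeal.mem_mk' _ _ _ _ _ _ _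

theorem toCalkin_surjective : Function.Surjective (toCalkin (H := H)) :=
  RingCon.mk'_surjective _

theorem toCalkin_mul (A B : H →L[ℂ] H) : toCalkin (A * B) = toCalkin A * toCalkin B := rfl

theorem toCalkin_one : toCalkin (1 : H →L[ℂ] H) = 1 := rfl

theorem algebraMap_sub_toCalkin (T : H →L[ℂ] H) (z : ℂ) :
    algebraMap ℂ (CalkinAlgebra H) z - toCalkin T = toCalkin (algebraMap ℂ _ z - T) := rfl

theorem exists_of_notMem_leftSpectrum_toCalkin {T : H →L[ℂ] H} {z : ℂ}
    (h : z ∉ leftSpectrum (toCalkin T)) :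
    ∃ S K : H →L[ℂ] H, IsCompactOperator K ∧ S * (algebraMap ℂ _ z - T) = 1 + K := by
  obtain ⟨s, hs⟩ := not_not.1 h
  obtain ⟨S, rfl⟩ := toCalkin_surjective s
  rw [algebraMap_sub_toCalkin, ← toCalkin_mul, ← toCalkin_one, toCalkin_eq_iff] at hs
  exact ⟨S, _, hs, (add_sub_cancel _ _).symm⟩

theorem exists_of_notMem_rightSpectrum_toCalkin {T : H →L[ℂ] H} {z : ℂ}
    (h : z ∉ rightSpectrum (toCalkin T)) :
    ∃ S K : H →L[ℂ] H, IsCompactOperator K ∧ (algebraMap ℂ _ z - T) * S = 1 + K := by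
  obtain ⟨s, hs⟩ := not_not.1 h
  obtain ⟨S, rfl⟩ := toCalkin_surjective s
  rw [algebraMap_sub_toCalkin, ← toCalkin_mul, ← toCalkin_one, toCalkin_eq_iff] at hs
  exact ⟨S, _, hs, (add_sub_cancel _ _).symm⟩

theorem wolfSpectrum_subset_spectrum (T : H →L[ℂ] H) : wolfSpectrum T ⊆ spectrum ℂ T := by
  rintro z ⟨hz, -⟩ hu
  obtain ⟨S, hS⟩ := hu.exists_left_inv
  exact hz ⟨toCalkin S, by rw [algebraMap_sub_toCalkin, ← toCalkin_mul, hS, toCalkin_one]⟩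

end Calkin

/-! ### Left spectrum and eigenvalues. -/

theorem leftSpectrum_subset_spectrum {A : Type*} [Ring A] [Algebra ℂ A] (t : A) :
    leftSpectrum t ⊆ spectrum ℂ t :=
  fun _ hz hu => hz hu.exists_left_inv

theorem notMem_pointSpectrum_iff {H : Type*} [NormedAddCommGroup H] [NormedSpace ℂ H]
    {T : H →L[ℂ] H} {z : ℂ} :
    z ∉ pointSpectrum T ↔ ∀ x, (algebraMap ℂ (H →L[ℂ] H) z - T) x = 0 → x = 0 := by
  have key : ∀ x, (algebraMap ℂ (H →L[ℂ] H) z - T) x = 0 ↔ T x = z • x := by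
    intro x
    rw [sub_apply, sub_eq_zero, Algebra.algebraMap_eq_smul_one]
    exact eq_comm
  simp only [key]
  refine ⟨fun h x hx => ?_, fun h hz => ?_⟩
  · by_contra hx0
    exact h (Module.End.hasEigenvalue_of_hasEigenvector
      ⟨Module.End.mem_eigenspace_iff.2 hx, hx0⟩)
  · obtain ⟨x, hx⟩ := Module.End.HasEigenvalue.exists_hasEigenvector hz
    exact hx.2 (h x hx.apply_eq_smul)

theorem exists_norm_le_of_notMem_leftSpectrum {H : Type*} [NormedAddCommGroup H]
    [NormedSpace ℂ H] {T : H →L[ℂ] H} {z : ℂ} (h : z ∉ leftSpectrum T) :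
    ∃ C : ℝ, ∀ x, ‖x‖ ≤ C * ‖(algebraMap ℂ (H →L[ℂ] H) z - T) x‖ := by
  obtain ⟨S, hS⟩ := not_not.1 h
  refine ⟨‖S‖, fun x => ?_⟩
  have := congrArg (fun B : H →L[ℂ] H => B x) hS
  simp only [mul_apply_eq_comp, one_apply_eq_self] at this
  calc ‖x‖ = ‖S ((algebraMap ℂ (H →L[ℂ] H) z - T) x)‖ := by rw [this]
    _ ≤ _ := S.le_opNorm _

theorem pointSpectrum_subset_leftSpectrum {H : Type*} [NormedAddCommGroup H]
    [NormedSpace ℂ H] (T : H →L[ℂ] H) : pointSpectrum T ⊆ leftSpectrum T := by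
  intro z hz
  by_contra h
  obtain ⟨C, hC⟩ := exists_norm_le_of_notMem_leftSpectrum h
  exact notMem_pointSpectrum_iff.2 (fun x hx => by simpa [hx] using hC x) hz

/-! ### The maximum principle for resolvents on invariant subspaces. -/

section MaximumPrinciple

variable {H : Type*} [NormedAddCommGroup H] [NormedSpace ℂ H]

theorem differentiableOn_resolvent_apply [CompleteSpace H] (T : H →L[ℂ] H) (v : H) {s : Set ℂ}
    (hs : s ⊆ resolventSet ℂ T) : DifferentiableOn ℂ (fun u => resolvent T u v) s := fun u hu =>
  ((ContinuousLinearMap.apply ℂ H v).differentiableAt.comp u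
    (spectrum.hasDerivAt_resolvent_const_left (hs hu)).differentiableAt).differentiableWithinAt

/-- On a finite-dimensional invariant subspace on which `z - T` is injective for all `z` in the
closure of a bounded set, a lower bound for `z - T` on the frontier propagates inside. -/
theorem norm_le_of_invariant_of_frontier {T : H →L[ℂ] H} (V : Submodule ℂ H)
    [FiniteDimensional ℂ V] (hV : ∀ x ∈ V, T x ∈ V) {U : Set ℂ} (hU : Bornology.IsBounded U)
    {M : ℝ} (hM : ∀ z ∈ frontier U, ∀ x, ‖x‖ ≤ M * ‖(algebraMap ℂ (H →L[ℂ] H) z - T) x‖)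
    (hinj : ∀ z ∈ closure U, ∀ x ∈ V, (algebraMap ℂ (H →L[ℂ] H) z - T) x = 0 → x = 0)
    {z : ℂ} (hz : z ∈ closure U) {w : H} (hw : w ∈ V) :
    ‖w‖ ≤ M * ‖(algebraMap ℂ (H →L[ℂ] H) z - T) w‖ := by
  have : CompleteSpace V := FiniteDimensional.complete ℂ V
  obtain ⟨B, hB⟩ : ∃ B : V →L[ℂ] V, ∀ (u : ℂ) (x : V),
      (((algebraMap ℂ (V →L[ℂ] V) u - B) x : V) : H) = (algebraMap ℂ (H →L[ℂ] H) u - T) x :=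
    ⟨(T ∘L V.subtypeL).codRestrict V fun x => hV x x.2, fun _ _ => rfl⟩
  have hres : ∀ u ∈ closure U, u ∈ resolventSet ℂ B := by
    intro u hu
    change IsUnit (algebraMap ℂ (V →L[ℂ] V) u - B)
    have hi : Function.Injective ((algebraMap ℂ (V →L[ℂ] V) u - B : V →L[ℂ] V) : V →ₗ[ℂ] V) := by
      refine (injective_iff_map_eq_zero _).2 fun x hx => Subtype.ext ?_
      refine hinj u hu x x.2 ?_
      rw [← hB u x]
      exact congrArg Subtype.val hx
    exact isUnit_iff_bijective.2 ⟨hi, LinearMap.injective_iff_surjective.1 hi⟩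
  have hright : ∀ u ∈ closure U, ∀ v : V,
      (algebraMap ℂ (V →L[ℂ] V) u - B) (resolvent B u v) = v := by
    intro u hu v
    have := Ring.mul_inverse_cancel _ (hres u hu)
    exact congrArg (fun A : V →L[ℂ] V => A v) this
  set v : V := (algebraMap ℂ (V →L[ℂ] V) z - B) ⟨w, hw⟩
  have hdiff : DiffContOnCl ℂ (fun u => resolvent B u v) U :=
    (differentiableOn_resolvent_apply B v hres).diffContOnCl
  have hmax := Complex.norm_le_of_forall_mem_frontier_norm_le hU hdiff (C := M * ‖v‖)
    -- `V` carries the norm of `H`, so the restriction inherits the constant `M`, whatever the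
    -- dimension of `V`.
    (fun u hu => by
      have h1 := hM u hu (resolvent B u v : V)
      rw [← hB, hright u (frontier_subset_closure hu)] at h1
      exact h1) hz
  have hleft : resolvent B z v = ⟨w, hw⟩ := by
    have := Ring.inverse_mul_cancel _ (hres z hz)
    exact congrArg (fun A : V →L[ℂ] V => A ⟨w, hw⟩) this
  rw [hleft, show ‖v‖ = ‖(v : H)‖ from rfl, hB] at hmax
  exact hmax

/-- A uniform lower bound for `z - T` on compact subsets of the resolvent set. -/
theorem exists_norm_le_of_isCompact [CompleteSpace H] {T : H →L[ℂ] H} {K : Set ℂ}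
    (hK : IsCompact K) (hKT : K ⊆ resolventSet ℂ T) :
    ∃ M : ℝ, ∀ z ∈ K, ∀ x, ‖x‖ ≤ M * ‖(algebraMap ℂ (H →L[ℂ] H) z - T) x‖ := by
  obtain ⟨M, hM⟩ := hK.exists_bound_of_continuousOn (f := resolvent T) fun z hz =>
    (spectrum.hasDerivAt_resolvent_const_left (hKT hz)).continuousAt.continuousWithinAt
  refine ⟨M, fun z hz x => ?_⟩
  have h1 : resolvent T z ((algebraMap ℂ (H →L[ℂ] H) z - T) x) = x :=
    congrArg (fun A : H →L[ℂ] H => A x) (Ring.inverse_mul_cancel _ (hKT hz))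
  calc ‖x‖ = ‖resolvent T z ((algebraMap ℂ (H →L[ℂ] H) z - T) x)‖ := by rw [h1]
    _ ≤ _ := (resolvent T z).le_of_opNorm_le (hM z hz) _

end MaximumPrinciple

/-! ### Finitely supported sequences. -/

/-- The subspace of `ℓ²` of the sequences supported in `{0, …, n - 1}`. -/
def supportedBelow (n : ℕ) : Submodule ℂ EllTwo where
  carrier := {x | ∀ j, n ≤ j → x j = 0}
  add_mem' hx hy j hj := by simp [hx j hj, hy j hj]
  zero_mem' j _ := by simp
  smul_mem' c x hx j hj := by simp [hx j hj]

theorem mem_supportedBelow {n : ℕ} {x : EllTwo} :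
    x ∈ supportedBelow n ↔ ∀ j, n ≤ j → x j = 0 := Iff.rfl

instance finiteDimensional_supportedBelow (n : ℕ) : FiniteDimensional ℂ (supportedBelow n) := by
  let f : supportedBelow n →ₗ[ℂ] (Fin n → ℂ) :=
    { toFun := fun x i => (x : EllTwo) i
      map_add' := fun x y => by ext; simp
      map_smul' := fun c x => by ext; simp }
  refine FiniteDimensional.of_injective f fun x y hxy => Subtype.ext (lp.ext (funext fun j => ?_))
  by_cases hj : j < n
  · exact congrFun hxy ⟨j, hj⟩
  · rw [x.2 j (not_lt.1 hj), y.2 j (not_lt.1 hj)]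

/-- The index `k` is the last one in the support; in that coordinate a triangular operator acts
through its diagonal entry alone. -/
theorem exists_mem_supportedBelow_apply_ne_zero {n : ℕ} {x : EllTwo} (hx : x ∈ supportedBelow n)
    (hx0 : x ≠ 0) : ∃ k, x k ≠ 0 ∧ x ∈ supportedBelow (k + 1) := by
  induction n with
  | zero => exact absurd (lp.ext (funext fun j => hx j j.zero_le)) hx0
  | succ n ih =>
    by_cases h : x n = 0
    · refine ih fun j hj => ?_
      rcases hj.eq_or_lt with rfl | hj
      · exact h
      · exact hx j hj
    · exact ⟨n, h, hx⟩

/-- A closed set containing all finitely supported sequences is everything. -/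
theorem forall_mem_of_isClosed_of_supportedBelow {s : Set EllTwo} (hs : IsClosed s)
    (h : ∀ n, ∀ x ∈ supportedBelow n, x ∈ s) (x : EllTwo) : x ∈ s := by
  have hsum := (lp.hasSum_single (p := 2) (by norm_num) x).tendsto_sum_nat
  refine hs.mem_of_tendsto hsum (Eventually.of_forall fun n => h n _ fun j hj => ?_)
  rw [lp.coeFn_sum, Finset.sum_apply]
  refine Finset.sum_eq_zero fun i hi => lp.single_apply_ne _ _ _ ?_
  have := Finset.mem_range.1 hi
  omega

/-! ### Triangular structure and eigenvalues of `R_a^*` and `R_a`. -/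

section Rhaly

variable {a : ℕ → ℂ} (ha : RhalyBounded a)

theorem rhalyOperator_single (k n : ℕ) :
    rhalyOperator a ha (lp.single 2 k 1) n = if k ≤ n then a n else 0 := by
  rw [rhalyOperator_apply]
  simp only [lp.single_apply, Pi.single_apply, Finset.sum_ite_eq', Finset.mem_range,
    Nat.lt_succ_iff, mul_ite, mul_one, mul_zero]

theorem adjoint_rhalyOperator_apply (y : EllTwo) (k : ℕ) :
    adjoint (rhalyOperator a ha) y k = ⟪rhalyOperator a ha (lp.single 2 k 1), y⟫_ℂ := by
  rw [← adjoint_inner_right, lp.inner_single_left]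
  simp

/-- Column `k` of `R_a` vanishes before `k` and `y` vanishes after `k`, so only the diagonal term
survives. -/
theorem adjoint_rhalyOperator_apply_of_mem {y : EllTwo} {k : ℕ}
    (hy : y ∈ supportedBelow (k + 1)) :
    adjoint (rhalyOperator a ha) y k = conj (a k) * y k := by
  rw [adjoint_rhalyOperator_apply]
  refine (lp.hasSum_inner _ _).unique ?_
  convert hasSum_single k (fun j hj => ?_) using 1
  · rw [rhalyOperator_single, if_pos le_rfl]
    simp [mul_comm]
  · rcases lt_or_gt_of_ne hj with h | h
    · rw [rhalyOperator_single, if_neg (not_le.2 h), inner_zero_left]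
    · rw [hy j h, inner_zero_right]

theorem adjoint_rhalyOperator_mem_supportedBelow {y : EllTwo} {n : ℕ}
    (hy : y ∈ supportedBelow n) : adjoint (rhalyOperator a ha) y ∈ supportedBelow n := by
  intro k hk
  rw [adjoint_rhalyOperator_apply_of_mem ha fun j hj => hy j (by omega), hy k hk, mul_zero]

/-- `z - R_a^*` is injective on finitely supported sequences if `z` is not a conjugated term. -/
theorem eq_zero_of_mem_supportedBelow {z : ℂ} (hz : ∀ n, z ≠ conj (a n)) {n : ℕ} {x : EllTwo}
    (hx : x ∈ supportedBelow n)
    (h : (algebraMap ℂ (EllTwo →L[ℂ] EllTwo) z - adjoint (rhalyOperator a ha)) x = 0) :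
    x = 0 := by
  by_contra hx0
  obtain ⟨k, hk, hxk⟩ := exists_mem_supportedBelow_apply_ne_zero hx hx0
  have h1 : z * x k - adjoint (rhalyOperator a ha) x k = 0 :=
    congrArg (fun y : EllTwo => y k) h
  rw [adjoint_rhalyOperator_apply_of_mem ha hxk, ← sub_mul] at h1
  exact (mul_ne_zero (sub_ne_zero.2 (hz k)) hk) h1

/-- On `supportedBelow (n + 1)` the operator `conj (a n) - R_a^*` kills coordinate `n`. It is thus
not surjective there, hence not injective, even if terms of `a` repeat. -/
theorem conj_mem_pointSpectrum (n : ℕ) :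
    conj (a n) ∈ pointSpectrum (adjoint (rhalyOperator a ha)) := by
  by_contra hn
  rw [notMem_pointSpectrum_iff] at hn
  set A := algebraMap ℂ (EllTwo →L[ℂ] EllTwo) (conj (a n)) - adjoint (rhalyOperator a ha)
  have hAV : ∀ x ∈ supportedBelow (n + 1), A x ∈ supportedBelow (n + 1) := fun x hx =>
    Submodule.sub_mem _ (Submodule.smul_mem _ _ hx) (adjoint_rhalyOperator_mem_supportedBelow ha hx)
  let B : supportedBelow (n + 1) →ₗ[ℂ] supportedBelow (n + 1) :=
    (A : EllTwo →ₗ[ℂ] EllTwo).restrict hAV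
  have hB : Function.Injective B := by
    refine (injective_iff_map_eq_zero _).2 fun x hx => Subtype.ext (hn x ?_)
    exact congrArg Subtype.val hx
  have hmem : (lp.single 2 n 1 : EllTwo) ∈ supportedBelow (n + 1) := fun j hj =>
    lp.single_apply_ne _ _ _ (by omega)
  obtain ⟨x, hx⟩ := LinearMap.injective_iff_surjective.1 hB ⟨_, hmem⟩
  have h1 : conj (a n) * (x : EllTwo) n - adjoint (rhalyOperator a ha) x n = 1 := by
    have : A x = lp.single 2 n 1 := congrArg Subtype.val hx
    have h2 := congrArg (fun y : EllTwo => y n) this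
    rw [lp.single_apply_self] at h2
    exact h2
  rw [adjoint_rhalyOperator_apply_of_mem ha x.2, sub_self] at h1
  exact zero_ne_one h1

/-- `R_a` has no eigenvalues outside the terms of `a`. -/
theorem eq_zero_of_rhalyOperator_eq_smul {μ : ℂ} (hμ : ∀ n, μ ≠ a n) {x : EllTwo}
    (hx : rhalyOperator a ha x = μ • x) : x = 0 := by
  have hcoord : ∀ n, a n * ∑ k ∈ Finset.range (n + 1), x k = μ * x n := fun n => by
    rw [← rhalyOperator_apply a ha, hx]; rfl
  -- If the sum before `n` vanishes, then `x n` equals the next partial sum, and `a n - μ ≠ 0`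
  -- annihilates it.
  have hs : ∀ n, ∑ k ∈ Finset.range n, x k = 0 := by
    intro n
    induction n with
    | zero => simp
    | succ n ih =>
      have h1 := hcoord n
      have h2 : x n = ∑ k ∈ Finset.range (n + 1), x k := by
        rw [Finset.sum_range_succ, ih, zero_add]
      rw [h2, ← sub_eq_zero, ← sub_mul] at h1
      exact (mul_eq_zero.1 h1).resolve_left (sub_ne_zero.2 (hμ n).symm)
  refine lp.ext (funext fun n => ?_)
  have h := hs (n + 1)
  rwa [Finset.sum_range_succ, hs n, zero_add] at h

/-- The adjoint of `z - R_a^*` is `conj z - R_a`, and `conj z` is not a term of `a`. -/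
theorem eq_zero_of_adjoint_eq_zero {z : ℂ} (hz : ∀ n, z ≠ conj (a n)) (x : EllTwo)
    (hx : adjoint (algebraMap ℂ (EllTwo →L[ℂ] EllTwo) z - adjoint (rhalyOperator a ha)) x = 0) :
    x = 0 := by
  refine eq_zero_of_rhalyOperator_eq_smul ha (μ := conj z) (fun n h => hz n ?_) ?_
  · rw [← h, Complex.conj_conj]
  · rw [map_sub, adjoint_adjoint, ← star_eq_adjoint, ← algebraMap_star_comm, sub_apply,
      sub_eq_zero] at hx
    exact hx.symm

theorem ne_conj_of_notMem_pointSpectrum {z : ℂ}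
    (hz : z ∉ pointSpectrum (adjoint (rhalyOperator a ha))) (n : ℕ) : z ≠ conj (a n) :=
  fun h => hz (h ▸ conj_mem_pointSpectrum ha n)

/-- The lower bound rules out eigenvalues, hence conjugated terms, and this makes the adjoint
injective. -/
theorem notMem_spectrum_of_norm_le {z : ℂ} {C : ℝ} (hC : ∀ x : EllTwo,
    ‖x‖ ≤ C * ‖(algebraMap ℂ (EllTwo →L[ℂ] EllTwo) z - adjoint (rhalyOperator a ha)) x‖) :
    z ∉ spectrum ℂ (adjoint (rhalyOperator a ha)) := by
  have hz := notMem_pointSpectrum_iff.2 fun x hx =>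
    norm_le_zero_iff.1 <| (hC x).trans_eq <| by rw [hx, norm_zero, mul_zero]
  exact not_not.2 (isUnit_of_norm_le_of_injective_adjoint hC
    (eq_zero_of_adjoint_eq_zero ha (ne_conj_of_notMem_pointSpectrum ha hz)))

theorem spectrum_eq_leftSpectrum :
    spectrum ℂ (adjoint (rhalyOperator a ha)) = leftSpectrum (adjoint (rhalyOperator a ha)) := by
  refine Subset.antisymm (fun z hz => ?_) (leftSpectrum_subset_spectrum _)
  by_contra h
  obtain ⟨C, hC⟩ := exists_norm_le_of_notMem_leftSpectrum h
  exact notMem_spectrum_of_norm_le ha hC hz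

theorem leftSpectrum_eq_wolfSpectrum_union_pointSpectrum :
    leftSpectrum (adjoint (rhalyOperator a ha)) =
      wolfSpectrum (adjoint (rhalyOperator a ha)) ∪
        pointSpectrum (adjoint (rhalyOperator a ha)) := by
  refine Subset.antisymm (fun z hz => ?_) (union_subset ?_ (pointSpectrum_subset_leftSpectrum _))
  swap
  · rw [← spectrum_eq_leftSpectrum]
    exact wolfSpectrum_subset_spectrum _
  rw [← spectrum_eq_leftSpectrum] at hz
  by_contra h
  obtain ⟨hw, hp⟩ := not_or.1 h
  have hne := ne_conj_of_notMem_pointSpectrum ha hp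
  rcases not_and_or.1 hw with hl | hr
  · obtain ⟨S, K, hK, hS⟩ := exists_of_notMem_leftSpectrum_toCalkin hl
    obtain ⟨C, hC⟩ := exists_norm_le_of_mul_eq_one_add hS hK.exists_cauchySeq
      (notMem_pointSpectrum_iff.1 hp)
    exact notMem_spectrum_of_norm_le ha hC hz
  · obtain ⟨S, K, hK, hS⟩ := exists_of_notMem_rightSpectrum_toCalkin hr
    -- Adjoints turn the right inverse modulo compacts into a left one, so the adjoint of `z -
    -- R_a^*` is the operator that is bounded below.
    have hS' := congrArg star hS
    rw [star_mul, star_add, star_one] at hS'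
    obtain ⟨C, hC⟩ := exists_norm_le_of_mul_eq_one_add hS' hK.exists_cauchySeq_adjoint
      (eq_zero_of_adjoint_eq_zero ha hne)
    have hu := isUnit_of_norm_le_of_injective_adjoint hC fun x hx => by
      rw [star_eq_adjoint, adjoint_adjoint] at hx
      exact notMem_pointSpectrum_iff.1 hp x hx
    exact hz (isUnit_star.1 hu)

/-! ### Clopen parts, components and isolated points of the spectrum. -/

/-- A compact relatively open part of the spectrum of `R_a^*` without conjugated terms of `a` is
empty. -/
theorem exists_conj_mem_of_isCompact {K L : Set ℂ} (hK : IsCompact K) (hL : IsCompact L)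
    (hKL : Disjoint K L) (hσ : spectrum ℂ (adjoint (rhalyOperator a ha)) = K ∪ L)
    (hne : K.Nonempty) : ∃ n, conj (a n) ∈ K := by
  by_contra! hcon
  obtain ⟨z, hz⟩ := hne
  -- Disjoint closed thickenings keep `closure U` off `L`; as `U` is open and contains `K`, its
  -- frontier also misses `K`.
  obtain ⟨δ, hδ, hdisj⟩ := hKL.exists_cthickenings hK hL.isClosed
  set U := Metric.thickening δ K
  have hKU : K ⊆ U := Metric.self_subset_thickening hδ K
  have hUb : Bornology.IsBounded U := hK.isBounded.thickening
  have hUL : ∀ u ∈ closure U, u ∉ L := fun u hu huL =>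
    disjoint_left.1 hdisj (Metric.closure_thickening_subset_cthickening δ K hu)
      (Metric.self_subset_cthickening L huL)
  have hfr : frontier U ⊆ resolventSet ℂ (adjoint (rhalyOperator a ha)) := by
    intro u hu
    by_contra h
    have : u ∈ K ∪ L := hσ ▸ h
    rcases this with h | h
    · rw [Metric.isOpen_thickening.frontier_eq] at hu
      exact hu.2 (hKU h)
    · exact hUL u (frontier_subset_closure hu) h
  have hne' : ∀ u ∈ closure U, ∀ n, u ≠ conj (a n) := by
    rintro u hu n rfl
    have : conj (a n) ∈ K ∪ L := hσ ▸ leftSpectrum_subset_spectrum _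
      (pointSpectrum_subset_leftSpectrum _ (conj_mem_pointSpectrum ha n))
    exact this.elim (hcon n) (hUL _ hu)
  have hcomp : IsCompact (frontier U) :=
    Metric.isCompact_of_isClosed_isBounded isClosed_frontier
      (hUb.closure.subset frontier_subset_closure)
  obtain ⟨M, hM⟩ := exists_norm_le_of_isCompact hcomp hfr
  refine notMem_spectrum_of_norm_le ha (z := z) (C := M) (fun x => ?_) (hσ ▸ Or.inl hz)
  -- Since `M` does not depend on `n`, the bound passes from finitely supported sequences to their
  -- closure.
  refine forall_mem_of_isClosed_of_supportedBelow (s := {x : EllTwo | ‖x‖ ≤ M *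
    ‖(algebraMap ℂ (EllTwo →L[ℂ] EllTwo) z - adjoint (rhalyOperator a ha)) x‖})
    (isClosed_le (by fun_prop) (by fun_prop)) (fun n w hw => ?_) x
  exact norm_le_of_invariant_of_frontier (supportedBelow n)
    (fun _ => adjoint_rhalyOperator_mem_supportedBelow ha) hUb hM
    (fun u hu _ hx => eq_zero_of_mem_supportedBelow ha (hne' u hu) hx)
    (subset_closure (hKU hz)) hw

theorem exists_conj_mem_of_isClopen {S : Set (spectrum ℂ (adjoint (rhalyOperator a ha)))}
    (hS : IsClopen S) (hne : S.Nonempty) : ∃ n : ℕ, ∃ z ∈ S, (z : ℂ) = conj (a n) := by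
  have : CompactSpace (spectrum ℂ (adjoint (rhalyOperator a ha))) :=
    isCompact_iff_compactSpace.1 (spectrum.isCompact _)
  obtain ⟨n, z, hz, hzn⟩ := exists_conj_mem_of_isCompact ha
    (hS.isClosed.isCompact.image continuous_subtype_val)
    (hS.compl.isClosed.isCompact.image continuous_subtype_val)
    ((disjoint_image_iff Subtype.val_injective).2 disjoint_compl_right)
    (by rw [← image_union, union_compl_self, image_univ, Subtype.range_coe]) (hne.image _)
  exact ⟨n, z, hz, hzn⟩

/-- In a compact Hausdorff space a component is the intersection of the clopen sets around the
point. Finite intersections of these are clopen and contain a conjugated term, so compactness gives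
a common point in the closure of the terms. -/
theorem connectedComponentIn_inter_closure_nonempty {z : ℂ}
    (hz : z ∈ spectrum ℂ (adjoint (rhalyOperator a ha))) :
    (connectedComponentIn (spectrum ℂ (adjoint (rhalyOperator a ha))) z ∩
      closure (range fun n : ℕ => conj (a n))).Nonempty := by
  have : CompactSpace (spectrum ℂ (adjoint (rhalyOperator a ha))) :=
    isCompact_iff_compactSpace.1 (spectrum.isCompact _)
  rw [connectedComponentIn_eq_image hz, connectedComponent_eq_iInter_isClopen]
  set F : Set (spectrum ℂ (adjoint (rhalyOperator a ha))) :=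
    Subtype.val ⁻¹' closure (range fun n : ℕ => conj (a n))
  have hF : IsCompact F := (isClosed_closure.preimage continuous_subtype_val).isCompact
  have hne : (F ∩ ⋂ s : {s : Set (spectrum ℂ (adjoint (rhalyOperator a ha))) //
      IsClopen s ∧ ⟨z, hz⟩ ∈ s}, (s : Set _)).Nonempty := by
    refine hF.inter_iInter_nonempty _ (fun s => s.2.1.isClosed) fun u => ?_
    have hcl : IsClopen (⋂ s ∈ u, (s : Set (spectrum ℂ (adjoint (rhalyOperator a ha))))) :=
      isClopen_biInter_finset fun s _ => s.2.1
    obtain ⟨n, w, hw, hwn⟩ := exists_conj_mem_of_isClopen ha hcl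
      ⟨⟨z, hz⟩, mem_iInter₂.2 fun s _ => s.2.2⟩
    exact ⟨w, subset_closure ⟨n, hwn.symm⟩, hw⟩
  obtain ⟨w, hwF, hw⟩ := hne
  exact ⟨w, ⟨w, hw, rfl⟩, hwF⟩

end Rhaly

theorem mainTheorem10 (a : ℕ → ℂ) (ha : RhalyBounded a) (T : EllTwo →L[ℂ] EllTwo)
    (hT : T = ContinuousLinearMap.adjoint (rhalyOperator a ha)) :
    (spectrum ℂ T = leftSpectrum T ∧ leftSpectrum T = wolfSpectrum T ∪ pointSpectrum T) ∧
    ((∀ S : Set (spectrum ℂ T), IsClopen S → S.Nonempty →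
        ∃ n : ℕ, ∃ z ∈ S, (z : ℂ) = starRingEnd ℂ (a n)) ∧
      (∀ z ∈ spectrum ℂ T,
        (connectedComponentIn (spectrum ℂ T) z ∩
          closure (Set.range fun n : ℕ => starRingEnd ℂ (a n))).Nonempty)) ∧
    (∀ z : spectrum ℂ T, IsOpen ({z} : Set (spectrum ℂ T)) →
      (z : ℂ) ∈ Set.range fun n : ℕ => starRingEnd ℂ (a n)) := by
  subst hT
  refine ⟨⟨spectrum_eq_leftSpectrum ha, leftSpectrum_eq_wolfSpectrum_union_pointSpectrum ha⟩,
    ⟨fun S hS hne => exists_conj_mem_of_isClopen ha hS hne,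
      fun z hz => connectedComponentIn_inter_closure_nonempty ha hz⟩, fun z hz => ?_⟩
  obtain ⟨n, w, rfl, hwn⟩ := exists_conj_mem_of_isClopen ha ⟨isClosed_singleton, hz⟩
    (singleton_nonempty z)
  exact ⟨n, hwn.symm⟩
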